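/- Let $G$ be a locally compact abelian (Hausdorff) group. A group compactification $(\iota_X,X)$ of $G$ is a compact (Hausdorff) group $X$ together with a continuous homomorphism $\iota_X:G\to X$ with dense image; $\mu_X$ denotes the normalized Haar measure on $X$, and $(\iota_b,bG)$ the Bohr compactification, i.e. the maximal group compactification of $G$. A bounded function $f:X\to\mathbb{C}$ is Riemann integrable if its set of points of discontinuity is a $\mu_X$-null set. A function $\phi:G\to\mathbb{C}$ is Hartman measurable if $\phi=\phi_b\circ\iota_b$ for some Riemann integrable $\phi_b$ on $bG$; the invariant mean $m_G$ on Hartman measurable functions is given by $m_G(\phi)=\int_{bG}\phi_b\,d\mu_b$ (this does not depend on the choice of $\phi_b$). Write $\tau_g\phi(h)=\phi(g+h)$, and let $\mathcal{F}(\phi)$ be the filter on $G$ generated by the sets $\{g\in G: m_G(|\phi-\tau_g\phi|)<\varepsilon\}$, $\varepsilon>0$. Let $\mathfrak{U}_{(\iota_X,X)}$ be the filter on $G$ generated by the sets $\iota_X^{-1}(U)$, $U$ a neighbourhood of $0_X$ in $X$. A Riemann integrable function $\phi^*:X\to\mathbb{C}$ on a group compactification $(\iota_X,X)$ is called an almost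 realization of $\phi$ if $m_G(|\phi-\phi^*\circ\iota_X|)=0$, and it is called aperiodic if $\ker d_{\phi^*}:=\{x\in X:\int_X|\phi^*-\tau_x\phi^*|\,d\mu_X=0\}=\{0_X\}$. Theorem. Every Hartman measurable function $\phi$ on $G$ has an aperiodic almost realization on some group compactification $(\iota_X,X)$ of $G$. If $\phi^*:X\to\mathbb{C}$ is any aperiodic almost realization of $\phi$ on any group compactification $(\iota_X,X)$ of $G$, then $\mathcal{F}(\phi)=\mathfrak{U}_{(\iota_X,X)}$. -/

import Mathlib

open MeasureTheory Set Filter Topology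

universe u v w

/-- The data making a type `X` into a group compactification of the topological abelian group `G`:
a compact Hausdorff group structure on `X` and a continuous homomorphism `ι : G → X` with dense
image. (Since `G` is abelian and `ι` has dense image, `X` is necessarily abelian.) -/
structure CompactificationOn (G : Type u) [AddCommGroup G] [TopologicalSpace G] (X : Type v) where
  [addCommGroup : AddCommGroup X]
  [topologicalSpace : TopologicalSpace X]
  [isTopologicalAddGroup : IsTopologicalAddGroup X]
  [compactSpace : CompactSpace X]
  [t2Space : T2Space X]
  ι : G →+ X
  continuous_ι : Continuous ι
  denseRange_ι : DenseRange ι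

/-- A group compactification `(ι_X, X)` of the topological abelian group `G`. -/
structure GroupCompactification (G : Type u) [AddCommGroup G] [TopologicalSpace G] where
  carrier : Type v
  str : CompactificationOn G carrier

namespace GroupCompactification

variable {G : Type u} [AddCommGroup G] [TopologicalSpace G]

instance : CoeSort (GroupCompactification.{u, v} G) (Type v) := ⟨carrier⟩

instance (X : GroupCompactification.{u, v} G) : AddCommGroup X := X.str.addCommGroup
instance (X : GroupCompactification.{u, v} G) : TopologicalSpace X := X.str.topologicalSpace
instance (X : GroupCompactification.{u, v} G) : IsTopologicalAddGroup X :=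
  X.str.isTopologicalAddGroup
instance (X : GroupCompactification.{u, v} G) : CompactSpace X := X.str.compactSpace
instance (X : GroupCompactification.{u, v} G) : T2Space X := X.str.t2Space
instance (X : GroupCompactification.{u, v} G) : MeasurableSpace X := borel X
instance (X : GroupCompactification.{u, v} G) : BorelSpace X := ⟨rfl⟩

/-- The canonical homomorphism `ι_X : G → X`. -/
def ι (X : GroupCompactification.{u, v} G) : G →+ X := X.str.ι

theorem continuous_ι (X : GroupCompactification.{u, v} G) : Continuous X.ι := X.str.continuous_ι

theorem denseRange_ι (X : GroupCompactification.{u, v} G) : DenseRange X.ι := X.str.denseRange_ι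

/-- The normalized Haar measure `μ_X` on a group compactification. -/
noncomputable def haar (X : GroupCompactification.{u, v} G) : Measure X :=
  Measure.addHaarMeasure ⊤

instance (X : GroupCompactification.{u, v} G) : IsProbabilityMeasure X.haar :=
  ⟨Measure.addHaarMeasure_self (K₀ := (⊤ : TopologicalSpace.PositiveCompacts X))⟩

instance (X : GroupCompactification.{u, v} G) : X.haar.IsAddHaarMeasure :=
  inferInstanceAs (Measure.addHaarMeasure ⊤ : Measure X).IsAddHaarMeasure

/-- `X.CoveredBy Y`: the compactification `X` is covered by `Y`, i.e. there is a continuous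
homomorphism `π : Y → X` with `π ∘ ι_Y = ι_X`. -/
def CoveredBy (X : GroupCompactification.{u, v} G) (Y : GroupCompactification.{u, w} G) : Prop :=
  ∃ π : Y →+ X, Continuous π ∧ ∀ g, π (Y.ι g) = X.ι g

/-- The index family for the Bohr compactification: all group compactifications of `G` whose
underlying set is a set of filters on `G`. Up to isomorphism this is all of them, because a point
`x` of a compactification is determined by the filter `comap ι (𝓝 x)`. -/
def Index (G : Type u) [AddCommGroup G] [TopologicalSpace G] : Type u :=
  Σ S : Set (Filter G), CompactificationOn G S

/-- The compactification with index `i`. -/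
def ofIndex (i : Index G) : GroupCompactification.{u, u} G := ⟨i.1, i.2⟩

/-- The diagonal homomorphism from `G` into the product of all its compactifications. -/
def diag (G : Type u) [AddCommGroup G] [TopologicalSpace G] :
    G →+ ((i : Index G) → ofIndex i) :=
  AddMonoidHom.mk' (fun g i => (ofIndex i).ι g) fun a b => by
    funext i
    simp

/-- The Bohr compactification `(ι_b, bG)` of `G`: the closure of the diagonal image of `G` in the
product of all group compactifications of `G`. It is the maximal group compactification, see
`coveredBy_bohr`. -/
def bohr (G : Type u) [AddCommGroup G] [TopologicalSpace G] : GroupCompactification.{u, u} G where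
  carrier := (diag G).range.topologicalClosure
  str :=
    { compactSpace := isCompact_iff_compactSpace.1
        (diag G).range.isClosed_topologicalClosure.isCompact
      ι := (AddSubgroup.inclusion (diag G).range.le_topologicalClosure).comp (diag G).rangeRestrict
      continuous_ι := Continuous.subtype_mk
        (continuous_pi fun i => (ofIndex i).continuous_ι) _
      denseRange_ι := by
        intro x
        rw [closure_subtype, ← range_comp]
        exact x.2 }

theorem comap_ι_nhds_neBot (X : GroupCompactification.{u, v} G) (x : X) :
    (comap X.ι (𝓝 x)).NeBot :=
  comap_neBot_iff.2 fun _ ht =>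
    let ⟨g, hg⟩ := X.denseRange_ι.exists_mem_open isOpen_interior ⟨x, mem_interior_iff_mem_nhds.2 ht⟩
    ⟨g, interior_subset hg⟩

theorem comap_ι_nhds_injective (X : GroupCompactification.{u, v} G) :
    Function.Injective fun x : X => comap X.ι (𝓝 x) := by
  intro x y h
  have hx : (comap X.ι (𝓝 x)).NeBot := X.comap_ι_nhds_neBot x
  have h2 : map X.ι (comap X.ι (𝓝 x)) ≤ 𝓝 y := by
    have h' : comap X.ι (𝓝 x) = comap X.ι (𝓝 y) := h
    rw [h']
    exact map_comap_le
  exact tendsto_nhds_unique (f := X.ι) (l := comap X.ι (𝓝 x)) map_comap_le h2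

/-- The Bohr compactification covers every group compactification, in every universe. -/
theorem coveredBy_bohr (X : GroupCompactification.{u, v} G) : X.CoveredBy (bohr G) := by
  let e := Equiv.ofInjective _ X.comap_ι_nhds_injective
  let t : TopologicalSpace (range fun x : X => comap X.ι (𝓝 x)) :=
    TopologicalSpace.induced e.symm inferInstance
  let a : AddCommGroup (range fun x : X => comap X.ι (𝓝 x)) := e.symm.addCommGroup
  let ea := e.symm.addEquiv
  have hind : IsInducing e.symm := ⟨rfl⟩
  let eh := e.symm.toHomeomorphOfIsInducing hind
  let i : Index G := ⟨range fun x : X => comap X.ι (𝓝 x),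
    { addCommGroup := a
      topologicalSpace := t
      isTopologicalAddGroup := topologicalAddGroup_induced ea
      compactSpace := eh.symm.compactSpace
      t2Space := eh.symm.t2Space
      ι := ea.symm.toAddMonoidHom.comp X.ι
      continuous_ι := eh.symm.continuous.comp X.continuous_ι
      denseRange_ι := eh.symm.surjective.denseRange.comp X.denseRange_ι eh.symm.continuous }⟩
  have hc : Continuous ea := eh.continuous
  refine ⟨(ea.toAddMonoidHom.comp (Pi.evalAddMonoidHom (fun j : Index G => ofIndex j) i)).comp
    (diag G).range.topologicalClosure.subtype, ?_, fun g => ?_⟩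
  · exact hc.comp ((continuous_apply i).comp continuous_subtype_val)
  · exact ea.apply_symm_apply (X.ι g)

/-- The pullback `𝔘_(ι_X, X)` to `G` of the neighbourhood filter of `0` in `X`: the filter
generated by the sets `ι_X⁻¹(U)`, `U` a neighbourhood of `0`. -/
def pullbackNhds (X : GroupCompactification.{u, v} G) : Filter G := comap X.ι (𝓝 0)

end GroupCompactification

section Hartman

variable {G : Type u} [AddCommGroup G] [TopologicalSpace G]
variable {E : Type w} [NormedAddCommGroup E]

/-- Riemann integrable functions on a group compactification: bounded functions whose set of points
of discontinuity is null for the normalized Haar measure. -/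
def RiemannIntegrable (X : GroupCompactification.{u, v} G) (f : X → E) : Prop :=
  (∃ C : ℝ, ∀ x, ‖f x‖ ≤ C) ∧ X.haar {x | ¬ ContinuousAt f x} = 0

/-- Hartman measurable functions on `G`: those which extend to a Riemann integrable function on the
Bohr compactification. -/
def HartmanMeasurable (φ : G → E) : Prop :=
  ∃ f : GroupCompactification.bohr G → E, RiemannIntegrable (GroupCompactification.bohr G) f ∧
    φ = f ∘ (GroupCompactification.bohr G).ι

/-- Two Riemann integrable functions inducing the same function on `G` are equal almost
everywhere. -/
theorem RiemannIntegrable.ae_eq {X : GroupCompactification.{u, v} G} {f₁ f₂ : X → E}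
    (h₁ : RiemannIntegrable X f₁) (h₂ : RiemannIntegrable X f₂) (h : f₁ ∘ X.ι = f₂ ∘ X.ι) :
    f₁ =ᵐ[X.haar] f₂ := by
  have c₁ : ∀ᵐ x ∂X.haar, ContinuousAt f₁ x := h₁.2
  have c₂ : ∀ᵐ x ∂X.haar, ContinuousAt f₂ x := h₂.2
  filter_upwards [c₁, c₂] with x k₁ k₂
  have := X.comap_ι_nhds_neBot x
  have t : Tendsto X.ι (comap X.ι (𝓝 x)) (𝓝 x) := tendsto_comap
  have t₁ := Tendsto.comp k₁ t
  rw [h] at t₁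
  exact tendsto_nhds_unique t₁ (Tendsto.comp k₂ t)

variable [NormedSpace ℝ E]

open Classical in
/-- The invariant mean `m_G` on the Hartman measurable functions: `m_G(φ)` is the Haar integral over
the Bohr compactification of any Riemann integrable function extending `φ`. It does not depend on
the extension, see `hartmanMean_comp`. (The value is `0` by convention if `φ` is not Hartman
measurable.) -/
noncomputable def hartmanMean (φ : G → E) : E :=
  if h : HartmanMeasurable φ then ∫ x, h.choose x ∂(GroupCompactification.bohr G).haar else 0

theorem hartmanMean_comp {f : GroupCompactification.bohr G → E}
    (hf : RiemannIntegrable (GroupCompactification.bohr G) f) :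
    hartmanMean (f ∘ (GroupCompactification.bohr G).ι) =
      ∫ x, f x ∂(GroupCompactification.bohr G).haar := by
  have h : HartmanMeasurable (f ∘ (GroupCompactification.bohr G).ι) := ⟨f, hf, rfl⟩
  rw [hartmanMean, dif_pos h]
  exact integral_congr_ae (h.choose_spec.1.ae_eq hf h.choose_spec.2.symm)

end Hartman

section Filters

variable {G : Type u} [AddCommGroup G] [TopologicalSpace G]

/-- `d_φ(g) = m_G(|φ - τ_g φ|)`, where `τ_g φ (h) = φ (g + h)`. -/
noncomputable def meanShift (φ : G → ℂ) (g : G) : ℝ :=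
  hartmanMean fun h => ‖φ h - φ (g + h)‖

/-- The filter `𝓕(φ)` on `G` generated by the sets `F(φ, ε) = {g | d_φ(g) < ε}`, `ε > 0`. -/
noncomputable def hartmanFilter (φ : G → ℂ) : Filter G :=
  Filter.generate {S | ∃ ε : ℝ, 0 < ε ∧ S = {g | meanShift φ g < ε}}

/-- `d_f(x) = ‖f - τ_x f‖₁` for a function `f` on a group compactification, where
`τ_x f (y) = f (x + y)`. -/
noncomputable def shiftNorm (X : GroupCompactification.{u, v} G) (f : X → ℂ) (x : X) : ℝ :=
  ∫ y, ‖f y - f (x + y)‖ ∂X.haar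

/-- `f` is aperiodic: `ker d_f = {x | d_f(x) = 0}` is trivial. -/
def Aperiodic (X : GroupCompactification.{u, v} G) (f : X → ℂ) : Prop :=
  {x : X | shiftNorm X f x = 0} = {0}

/-- `f` is an almost realization of `φ` on `X`: it is Riemann integrable and
`m_G(|φ - f ∘ ι_X|) = 0`. -/
def AlmostRealization (φ : G → ℂ) (X : GroupCompactification.{u, v} G) (f : X → ℂ) : Prop :=
  RiemannIntegrable X f ∧ hartmanMean (fun g => ‖φ g - f (X.ι g)‖) = 0

end Filters

/-!
For a Riemann integrable function `f` on a group compactification `X` write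
`d_f(x) = ∫ |f - τ_x f| dμ_X`. Both halves of the theorem come from comparing `d_f` along covering
maps `π : Y → X` of compactifications. Such a map is surjective and, by uniqueness of Haar measure,
measure preserving, so `d_{f ∘ π} = d_f ∘ π` (`shiftNorm_comp_hom`). Moreover `d_f` only depends on
the almost everywhere class of `f`, and it is continuous because translation is continuous in `L¹`
(`continuous_shiftNorm`).

*Existence.* Let `f` on `bG` extend `φ`. The set `K = ker d_f` is a closed subgroup, and `f` agrees
almost everywhere with `q ∘ π` for some Riemann integrable `q` on `bG / K`, where `π` is the
projection (`exists_riemannIntegrable_quotient`). As `d_f = d_q ∘ π`, the kernel of `d_q` is trivial.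
The value of `q` at a coset is a cluster value of `f` along neighbourhoods modulo null sets; the set
of these cluster values is constant on cosets of `K`, and it shrinks to `f x` near each continuity
point `x` of `f`.

*The filter.* If `q` on `X` almost realizes `φ`, its pullback to `bG` equals `f` almost everywhere,
whence `m_G(|φ - τ_g φ|) = d_q(ι_X g)` (`AlmostRealization.meanShift_eq`). If `q` is aperiodic, `d_q`
is a continuous function on a compact space vanishing only at `0`, so the sets `{d_q < ε}` form a
basis of neighbourhoods of `0` (`Aperiodic.nhds_zero_eq_comap`). Pulling this basis back along `ι_X`
gives the equality of filters.
-/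

/-! ### Covering maps, quotients and Haar measure -/

namespace GroupCompactification

variable {G : Type u} [AddCommGroup G] [TopologicalSpace G]

/-- A covering map has compact, hence closed, image, and this image contains the dense set
`ι_X(G)`. -/
theorem CoveredBy.surjective {X : GroupCompactification.{u, v} G}
    {Y : GroupCompactification.{u, w} G} {π : Y →+ X} (hπ : Continuous π)
    (h : ∀ g, π (Y.ι g) = X.ι g) : Function.Surjective π := by
  have hd : DenseRange π := X.denseRange_ι.mono (by
    rintro _ ⟨g, rfl⟩
    exact ⟨Y.ι g, h g⟩)
  exact range_eq_univ.1 ((isCompact_range hπ).isClosed.closure_eq ▸ hd.closure_range)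

/-- By uniqueness of Haar measure a covering map carries `μ_Y` to `μ_X`. -/
theorem measurePreserving_hom {X : GroupCompactification.{u, v} G}
    {Y : GroupCompactification.{u, w} G} {π : Y →+ X} (hπ : Continuous π)
    (h : ∀ g, π (Y.ι g) = X.ι g) : MeasurePreserving π Y.haar X.haar :=
  AddMonoidHom.measurePreserving hπ (CoveredBy.surjective hπ h) (by simp)

theorem measurePreserving_shift (X : GroupCompactification.{u, v} G) (x : X) :
    MeasurePreserving (fun y => x + y) X.haar X.haar :=
  measurePreserving_add_left X.haar x

/-- The quotient of a group compactification by a closed subgroup. -/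
def quotient (X : GroupCompactification.{u, v} G) (K : AddSubgroup X)
    (hK : IsClosed (K : Set X)) : GroupCompactification.{u, v} G where
  carrier := X ⧸ K
  str :=
    have : IsClosed (K : Set X) := hK
    { ι := (QuotientAddGroup.mk' K).comp X.ι
      continuous_ι := continuous_quotient_mk'.comp X.continuous_ι
      denseRange_ι := (QuotientAddGroup.mk'_surjective K).denseRange.comp X.denseRange_ι
        continuous_quotient_mk' }

/-- The canonical projection onto the quotient of a group compactification. -/
def quotientMk (X : GroupCompactification.{u, v} G) (K : AddSubgroup X)
    (hK : IsClosed (K : Set X)) : X →+ X.quotient K hK :=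
  QuotientAddGroup.mk' K

section quotient

variable (X : GroupCompactification.{u, v} G) (K : AddSubgroup X) (hK : IsClosed (K : Set X))

theorem isOpenQuotientMap_quotientMk : IsOpenQuotientMap (X.quotientMk K hK) :=
  QuotientAddGroup.isOpenQuotientMap_mk

theorem quotientMk_ι (g : G) : X.quotientMk K hK (X.ι g) = (X.quotient K hK).ι g := rfl

theorem quotientMk_eq_iff {x y : X} :
    X.quotientMk K hK x = X.quotientMk K hK y ↔ -x + y ∈ K :=
  QuotientAddGroup.eq

theorem quotientMk_eq_zero_iff {x : X} : X.quotientMk K hK x = 0 ↔ x ∈ K :=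
  QuotientAddGroup.eq_zero_iff x

end quotient

/-- Haar measure charges every nonempty open set, so no neighbourhood is disjoint from a conull
set. -/
theorem nhds_inf_ae_neBot (X : GroupCompactification.{u, v} G) (x : X) :
    (𝓝 x ⊓ ae X.haar).NeBot := by
  refine inf_neBot_iff.2 fun {s} hs {t} ht => ?_
  by_contra hne
  have hst : s ⊆ tᶜ := fun y hy hyt => hne ⟨y, hy, hyt⟩
  exact (Measure.measure_pos_of_mem_nhds X.haar hs).ne' (measure_mono_null hst ht)

/-- Translation carries neighbourhoods modulo null sets to neighbourhoods modulo null sets. -/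
theorem tendsto_shift_nhds_inf_ae (X : GroupCompactification.{u, v} G) (x y : X) :
    Tendsto (fun z => x + z) (𝓝 y ⊓ ae X.haar) (𝓝 (x + y) ⊓ ae X.haar) :=
  ((continuous_const.add continuous_id).tendsto y).inf
    (X.measurePreserving_shift x).quasiMeasurePreserving.tendsto_ae

end GroupCompactification

open GroupCompactification

/-! ### Riemann integrable functions -/

namespace RiemannIntegrable

variable {G : Type u} [AddCommGroup G] [TopologicalSpace G]
variable {X : GroupCompactification.{u, v} G} {Y : GroupCompactification.{u, w} G}

theorem ae_continuousAt {E : Type*} [NormedAddCommGroup E] {f : X → E}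
    (hf : RiemannIntegrable X f) : ∀ᵐ x ∂X.haar, ContinuousAt f x := hf.2

theorem comp_measurePreserving {E : Type*} [NormedAddCommGroup E] {f : X → E}
    (hf : RiemannIntegrable X f) {π : Y → X} (hπ : Continuous π)
    (hm : MeasurePreserving π Y.haar X.haar) : RiemannIntegrable Y (fun y => f (π y)) := by
  refine ⟨hf.1.imp fun C hC y => hC _, ?_⟩
  have h : ∀ᵐ y ∂Y.haar, ContinuousAt f (π y) :=
    hm.quasiMeasurePreserving.ae hf.ae_continuousAt
  exact h.mono fun y hy => hy.comp (f := π) hπ.continuousAt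

theorem comp_shift {E : Type*} [NormedAddCommGroup E] {f : X → E}
    (hf : RiemannIntegrable X f) (x : X) : RiemannIntegrable X (fun y => f (x + y)) :=
  hf.comp_measurePreserving (continuous_const.add continuous_id) (X.measurePreserving_shift x)

theorem norm_sub {f g : X → ℂ} (hf : RiemannIntegrable X f) (hg : RiemannIntegrable X g) :
    RiemannIntegrable X (fun x => ‖f x - g x‖) := by
  obtain ⟨C, hC⟩ := hf.1
  obtain ⟨D, hD⟩ := hg.1
  refine ⟨⟨C + D, fun x => ?_⟩, ?_⟩
  · rw [norm_norm]
    exact (norm_sub_le _ _).trans (add_le_add (hC x) (hD x))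
  · have h : ∀ᵐ x ∂X.haar, ContinuousAt (fun x => ‖f x - g x‖) x := by
      filter_upwards [hf.ae_continuousAt, hg.ae_continuousAt] with x h₁ h₂
      exact (h₁.sub h₂).norm
    exact h

theorem integrable {f : X → ℂ} (hf : RiemannIntegrable X f) : Integrable f X.haar := by
  obtain ⟨C, hC⟩ := hf.1
  refine Integrable.of_bound ?_ C (ae_of_all _ hC)
  -- `f` is measurable because it is continuous on the conull `Gδ` set of its continuity points.
  have hm : MeasurableSet {x | ContinuousAt f x} := (IsGδ.setOfPred_continuousAt f).measurableSet
  have h : AEStronglyMeasurable f (X.haar.restrict {x | ContinuousAt f x}) :=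
    ContinuousOn.aestronglyMeasurable (fun x hx => ContinuousAt.continuousWithinAt hx) hm
  have hr : X.haar.restrict {x | ContinuousAt f x} = X.haar :=
    Measure.restrict_eq_self_of_ae_mem hf.ae_continuousAt
  rwa [hr] at h

theorem integrable_norm_sub {f g : X → ℂ} (hf : RiemannIntegrable X f)
    (hg : RiemannIntegrable X g) : Integrable (fun x => ‖f x - g x‖) X.haar :=
  (hf.integrable.sub hg.integrable).norm

theorem integral_norm_sub_eq_zero_iff {f g : X → ℂ} (hf : RiemannIntegrable X f)
    (hg : RiemannIntegrable X g) : ∫ x, ‖f x - g x‖ ∂X.haar = 0 ↔ f =ᵐ[X.haar] g := by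
  rw [integral_eq_zero_iff_of_nonneg (fun _ => norm_nonneg _) (hf.integrable_norm_sub hg)]
  simp [EventuallyEq, sub_eq_zero]

end RiemannIntegrable

/-! ### The shift distance and its kernel -/

section shiftNorm

variable {G : Type u} [AddCommGroup G] [TopologicalSpace G]
variable {X : GroupCompactification.{u, v} G} {Y : GroupCompactification.{u, w} G}

theorem shiftNorm_nonneg (f : X → ℂ) (x : X) : 0 ≤ shiftNorm X f x :=
  integral_nonneg fun _ => norm_nonneg _

theorem shiftNorm_eq_zero_iff {f : X → ℂ} (hf : RiemannIntegrable X f) {x : X} :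
    shiftNorm X f x = 0 ↔ f =ᵐ[X.haar] fun y => f (x + y) :=
  hf.integral_norm_sub_eq_zero_iff (hf.comp_shift x)

theorem shiftNorm_congr_ae {f g : X → ℂ} (h : f =ᵐ[X.haar] g) : shiftNorm X f = shiftNorm X g := by
  funext x
  refine integral_congr_ae ?_
  filter_upwards [h, (X.measurePreserving_shift x).quasiMeasurePreserving.ae h] with y h₁ h₂
  rw [h₁, h₂]

theorem shiftNorm_comp_hom {f : X → ℂ} (hf : RiemannIntegrable X f) {π : Y →+ X}
    (hπ : Continuous π) (h : ∀ g, π (Y.ι g) = X.ι g) (y : Y) :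
    shiftNorm Y (fun z => f (π z)) y = shiftNorm X f (π y) := by
  have hm := measurePreserving_hom hπ h
  have hi := (hf.integrable_norm_sub (hf.comp_shift (π y))).aestronglyMeasurable
  rw [← hm.map_eq] at hi
  rw [shiftNorm, shiftNorm, ← hm.map_eq, integral_map hπ.aemeasurable hi]
  simp only [map_add]

/-- Translation is continuous in `L¹`, hence so is the distance of `f` to its translates. -/
theorem continuous_shiftNorm {f : X → ℂ} (hf : RiemannIntegrable X f) :
    Continuous (shiftNorm X f) := by
  have hfi : MemLp f 1 X.haar := memLp_one_iff_integrable.2 hf.integrable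
  let g : C(X, C(X, X)) := (ContinuousMap.mk (fun p : X × X => p.1 + p.2) continuous_add).curry
  have hg (x : X) : MeasurePreserving (g x) X.haar X.haar := X.measurePreserving_shift x
  have hR : X.haar.Regular := inferInstanceAs (Measure.addHaarMeasure ⊤ : Measure X).Regular
  have hc : Continuous fun x => Lp.compMeasurePreserving (g x) (hg x) (hfi.toLp f) :=
    (continuous_const (y := hfi.toLp f)).compMeasurePreservingLp g.continuous hg (by simp)
  convert! (continuous_const (y := hfi.toLp f)).dist hc with x
  rw [Lp.toLp_compMeasurePreserving, dist_eq_norm, ← MemLp.toLp_sub, L1.norm_eq_integral_norm]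
  refine integral_congr_ae ?_
  filter_upwards [(hfi.sub (hfi.comp_measurePreserving (hg x))).coeFn_toLp] with y hy
  rw [hy]
  rfl

/-- The subgroup `ker d_f` of those `x` with `f = τ_x f` almost everywhere. -/
def shiftKernel {f : X → ℂ} (hf : RiemannIntegrable X f) : AddSubgroup X where
  carrier := {x | shiftNorm X f x = 0}
  zero_mem' := (shiftNorm_eq_zero_iff hf).2 (by simp)
  add_mem' {x y} hx hy := by
    simp only [mem_ofPred_eq, shiftNorm_eq_zero_iff hf] at hx hy ⊢
    filter_upwards [hy, (X.measurePreserving_shift y).quasiMeasurePreserving.ae hx] with z h₁ h₂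
    rw [h₁, h₂, add_assoc]
  neg_mem' {x} hx := by
    simp only [mem_ofPred_eq, shiftNorm_eq_zero_iff hf] at hx ⊢
    filter_upwards [(X.measurePreserving_shift (-x)).quasiMeasurePreserving.ae hx] with z h
    rw [h, add_neg_cancel_left]

theorem mem_shiftKernel {f : X → ℂ} (hf : RiemannIntegrable X f) {x : X} :
    x ∈ shiftKernel hf ↔ shiftNorm X f x = 0 := Iff.rfl

theorem isClosed_shiftKernel {f : X → ℂ} (hf : RiemannIntegrable X f) :
    IsClosed (shiftKernel hf : Set X) :=
  isClosed_eq (continuous_shiftNorm hf) continuous_const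

/-- On a compact space a continuous function whose only zero is `0` determines the
neighbourhoods of `0`. -/
theorem Aperiodic.nhds_zero_eq_comap {f : X → ℂ} (hf : RiemannIntegrable X f)
    (ha : Aperiodic X f) : 𝓝 (0 : X) = comap (shiftNorm X f) (𝓝 0) := by
  have hc := continuous_shiftNorm hf
  have hz (x : X) : shiftNorm X f x = 0 ↔ x = 0 := Set.ext_iff.1 ha x
  refine le_antisymm ?_ (le_nhds_of_unique_clusterPt fun x hx => ?_)
  · exact tendsto_iff_comap.1 ((hz 0).2 rfl ▸ hc.tendsto 0)
  · rw [← hz]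
    have h : ClusterPt (shiftNorm X f x) (𝓝 0) := hx.map hc.continuousAt tendsto_comap
    exact eq_of_nhds_neBot h

/-- A Riemann integrable function agrees almost everywhere with the pullback of a Riemann integrable
function on the quotient by `shiftKernel`. Since `f` is invariant under each element of the kernel
only up to a null set depending on that element, its values cannot be used directly; its cluster
values along `𝓝 x ⊓ ae μ` are invariant for every `x`. -/
theorem exists_riemannIntegrable_quotient {f : X → ℂ} (hf : RiemannIntegrable X f) :
    ∃ q : X.quotient (shiftKernel hf) (isClosed_shiftKernel hf) → ℂ,
      RiemannIntegrable _ q ∧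
      f =ᵐ[X.haar] fun x => q (X.quotientMk (shiftKernel hf) (isClosed_shiftKernel hf) x) := by
  set Q := X.quotient (shiftKernel hf) (isClosed_shiftKernel hf)
  set π := X.quotientMk (shiftKernel hf) (isClosed_shiftKernel hf)
  have hq : IsOpenQuotientMap π := isOpenQuotientMap_quotientMk _ _ _
  have hm : MeasurePreserving π X.haar Q.haar :=
    measurePreserving_hom hq.continuous (quotientMk_ι _ _ _)
  obtain ⟨C, hC⟩ := hf.1
  have hex (x : X) : ∃ c ∈ Metric.closedBall (0 : ℂ) C, MapClusterPt c (𝓝 x ⊓ ae X.haar) f := by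
    have := X.nhds_inf_ae_neBot x
    exact (isCompact_closedBall 0 C).exists_mapClusterPt
      (le_principal_iff.2 (mem_map.2 (univ_mem' fun y => by simpa using hC y)))
  choose c hcC hc using hex
  -- `c x` is an essential cluster value of `f` at `x`: one that survives deleting null sets. The
  -- function on the quotient is `c` at a chosen representative of each coset.
  let s : Q → X := Function.surjInv hq.surjective
  have hs (p : Q) : π (s p) = p := Function.surjInv_eq hq.surjective p
  -- The essential cluster values of `f` at `x` depend only on the coset of `x`.
  have key (x : X) : MapClusterPt (c (s (π x))) (𝓝 x ⊓ ae X.haar) f := by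
    set y := s (π x)
    have hk : -y + x ∈ shiftKernel hf :=
      (quotientMk_eq_iff X _ (isClosed_shiftKernel hf)).1 (hs (π x))
    rw [mem_shiftKernel, shiftNorm_eq_zero_iff hf] at hk
    have ht := X.tendsto_shift_nhds_inf_ae (x - y) y
    rw [sub_add_cancel] at ht
    have h₁ : MapClusterPt (c y) (𝓝 y ⊓ ae X.haar) fun z => f (x - y + z) := by
      refine (hc y).congrFun ?_
      refine mem_inf_of_right ?_
      filter_upwards [hk] with z hz
      rw [hz, sub_eq_neg_add]
    exact MapClusterPt.of_comp ht h₁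
  -- A closed set containing the values of `f` near `x` contains its essential cluster values.
  have hval {x : X} {t : Set ℂ} (ht : IsClosed t) (hx : ∀ᶠ y in 𝓝 x, f y ∈ t) :
      c (s (π x)) ∈ t := by
    have h : ∃ᶠ z in 𝓝 (c (s (π x))), z ∈ t := by
      have := (key x).clusterPt
      exact (this.frequently' (mem_map.2 (mem_inf_of_left hx)))
    exact ht.closure_subset (mem_closure_iff_frequently.2 h)
  -- At a continuity point `x` of `f` the only essential cluster value is `f x`, and at points near
  -- `x` all of them are close to `f x`; the open map `π` transports this to the quotient.
  have hcont {x : X} (hx : ContinuousAt f x) :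
      c (s (π x)) = f x ∧ ContinuousAt (fun p => c (s p)) (π x) := by
    have hball (ε : ℝ) (hε : 0 < ε) : ∀ᶠ y in 𝓝 x, f y ∈ Metric.closedBall (f x) ε :=
      hx (Metric.closedBall_mem_nhds _ hε)
    have heq : c (s (π x)) = f x :=
      eq_of_forall_dist_le fun ε hε => hval Metric.isClosed_closedBall (hball ε hε)
    refine ⟨heq, ?_⟩
    rw [ContinuousAt, heq, ← hq.map_nhds_eq, tendsto_map'_iff,
      Metric.nhds_basis_closedBall.tendsto_right_iff]
    intro ε hε
    filter_upwards [(hball ε hε).eventually_nhds] with y hy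
    exact hval Metric.isClosed_closedBall hy
  refine ⟨fun p => c (s p), ⟨⟨C, fun p => by simpa using hcC (s p)⟩, ?_⟩, ?_⟩
  · have hmeas : MeasurableSet {p : Q | ¬ ContinuousAt (fun p => c (s p)) p} :=
      (IsGδ.setOfPred_continuousAt fun p => c (s p)).measurableSet.compl
    rw [← hm.measure_preimage hmeas.nullMeasurableSet]
    have h : ∀ᵐ x ∂X.haar, ContinuousAt (fun p => c (s p)) (π x) :=
      hf.ae_continuousAt.mono fun x hx => (hcont hx).2
    exact h
  · exact hf.ae_continuousAt.mono fun x hx => (hcont hx).1.symm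

end shiftNorm

/-! ### Passage from the Bohr compactification to the group -/

section mean

variable {G : Type u} [AddCommGroup G] [TopologicalSpace G]

/-- The shift distance on `G` is the restriction of the shift distance on the Bohr
compactification. -/
theorem meanShift_comp_ι {f : bohr G → ℂ} (hf : RiemannIntegrable (bohr G) f) (g : G) :
    meanShift (f ∘ (bohr G).ι) g = shiftNorm (bohr G) f ((bohr G).ι g) := by
  rw [shiftNorm, ← hartmanMean_comp (hf.norm_sub (hf.comp_shift _)), meanShift]
  congr 1
  funext h
  simp

/-- Almost realizations, transported to the Bohr compactification: `q` almost realizes the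
restriction of `f` exactly when the pullback of `q` along the covering map agrees with `f` almost
everywhere. -/
theorem almostRealization_iff {f : bohr G → ℂ} (hf : RiemannIntegrable (bohr G) f)
    {X : GroupCompactification.{u, v} G} {q : X → ℂ} (hq : RiemannIntegrable X q)
    {π : bohr G →+ X} (hπ : Continuous π) (h : ∀ g, π ((bohr G).ι g) = X.ι g) :
    AlmostRealization (f ∘ (bohr G).ι) X q ↔ f =ᵐ[(bohr G).haar] fun y => q (π y) := by
  have hqπ := hq.comp_measurePreserving hπ (measurePreserving_hom hπ h)
  have hmean : hartmanMean (fun g => ‖(f ∘ (bohr G).ι) g - q (X.ι g)‖) =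
      ∫ y, ‖f y - q (π y)‖ ∂(bohr G).haar := by
    rw [← hartmanMean_comp (hf.norm_sub hqπ)]
    congr 1
    funext g
    simp [h]
  rw [AlmostRealization, hmean, hf.integral_norm_sub_eq_zero_iff hqπ]
  exact and_iff_right hq

/-- The shift distance of `φ` can be computed on any compactification carrying an almost
realization. -/
theorem AlmostRealization.meanShift_eq {φ : G → ℂ} (hφ : HartmanMeasurable φ)
    {X : GroupCompactification.{u, v} G} {q : X → ℂ} (h : AlmostRealization φ X q) (g : G) :
    meanShift φ g = shiftNorm X q (X.ι g) := by
  obtain ⟨f, hf, rfl⟩ := hφ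
  obtain ⟨π, hπ, hι⟩ := coveredBy_bohr X
  have hae := (almostRealization_iff hf h.1 hπ hι).1 h
  rw [meanShift_comp_ι hf, shiftNorm_congr_ae hae, shiftNorm_comp_hom h.1 hπ hι, hι]

/-- The generating sets `{g | meanShift φ g < ε}` form a basis, being nested in `ε`. -/
theorem hartmanFilter_eq_comap {φ : G → ℂ} (h : ∀ g, 0 ≤ meanShift φ g) :
    hartmanFilter φ = comap (meanShift φ) (𝓝 0) := by
  have hb : (comap (meanShift φ) (𝓝 0)).HasBasis (fun ε : ℝ => 0 < ε)
      fun ε => {g | meanShift φ g < ε} := by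
    convert! Metric.nhds_basis_ball.comap (meanShift φ) using 3 with ε
    ext g
    simp [abs_of_nonneg (h g)]
  refine le_antisymm (hb.ge_iff.2 fun ε hε => mem_generate_of_mem ⟨ε, hε, rfl⟩) ?_
  rw [hartmanFilter, le_generate_iff]
  rintro _ ⟨ε, hε, rfl⟩
  exact hb.mem_of_mem hε

end mean

theorem theorem2 {G : Type u} [AddCommGroup G] [TopologicalSpace G] [IsTopologicalAddGroup G]
    [LocallyCompactSpace G] [T2Space G] (φ : G → ℂ) (hφ : HartmanMeasurable φ) :
    (∃ (X : GroupCompactification.{u, u} G) (f : X → ℂ),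
      AlmostRealization φ X f ∧ Aperiodic X f) ∧
    (∀ (X : GroupCompactification.{u, v} G) (f : X → ℂ),
      AlmostRealization φ X f → Aperiodic X f → hartmanFilter φ = X.pullbackNhds) := by
  constructor
  · obtain ⟨f, hf, rfl⟩ := hφ
    obtain ⟨q, hq, hfq⟩ := exists_riemannIntegrable_quotient hf
    have hπ := ((bohr G).isOpenQuotientMap_quotientMk _ (isClosed_shiftKernel hf))
    have hι := (bohr G).quotientMk_ι _ (isClosed_shiftKernel hf)
    refine ⟨_, q, (almostRealization_iff hf hq hπ.continuous hι).2 hfq, ?_⟩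
    ext p
    obtain ⟨x, rfl⟩ := hπ.surjective p
    rw [mem_ofPred_eq, ← shiftNorm_comp_hom hq hπ.continuous hι, ← shiftNorm_congr_ae hfq,
      mem_singleton_iff, quotientMk_eq_zero_iff, mem_shiftKernel]
  · intro X f hr ha
    have hm : meanShift φ = shiftNorm X f ∘ X.ι := funext (hr.meanShift_eq hφ)
    rw [hartmanFilter_eq_comap fun g => hm ▸ shiftNorm_nonneg f _, pullbackNhds,
      ha.nhds_zero_eq_comap hr.1, comap_comap, hm]
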